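/- Let $\mathtt{Dia}$ be a ($1$- and $2$-)full sub-$2$-category of the $2$-category of small categories which contains the finite posets and is closed under opposites, finite products, finite coproducts and the comma categories $f\downarrow y$ of functors $f\colon X\to Y$ in $\mathtt{Dia}$ over objects $y$ of $Y$. A prederivator is a strict $2$-functor $\mathbb D\colon \mathtt{Dia}^{\mathrm{op}}\to \mathtt{Cat}$, $X\mapsto \mathbb D(X)$, $f\mapsto f^*$, $\alpha\mapsto\alpha^*$. It is a pointed right derivator if: (Der1) $\mathbb D(X\sqcup Y)\to\mathbb D(X)\times\mathbb D(Y)$ is an equivalence for all $X,Y$ in $\mathtt{Dia}$, and $\mathbb D(\varnothing)$ is equivalent to the final category $e$; (Der2) for each $X$ in $\mathtt{Dia}$, a morphism of $\mathbb D(X)$ is an isomorphism if its images under $i_x^*\colon\mathbb D(X)\to\mathbb D(e)$ are isomorphisms for all objects $x$ of $X$, where $i_x\colon e\to X$ has value $x$; (Der3) every $f^*$ has a left adjoint $f_!$; (Der4) for every $f\colon X\to Y$ in $\mathtt{Dia}$ and $y$ in $Y$, with projections $j\colon f\downarrow y\to X$ and $p\colon f\downarrow y\to e$, the Beck--Chevalley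 transformation $p_!\,j^*\Rightarrow i_y^*f_!$ is an isomorphism; and every $\mathbb D(X)$ has a zero object and every $f^*$ preserves zero objects. An object $F$ of $\mathbb D(\square)$, where $\square=[1]\times[1]$, is cocartesian if the counit $(i_\ulcorner)_!(i_\ulcorner)^*F\to F$ is an isomorphism, where $i_\ulcorner$ is the inclusion of $\square\setminus\{(1,1)\}$. Let $\mathbb D$ be a pointed right derivator and let $\operatorname{Ar}[n]$ be the poset of arrows $i\to j$ of $[n]=\{0<\dots<n\}$. Let $\mathsf s_\bullet\mathbb D$ be the simplicial set whose $n$-simplices are the objects $F$ of $\mathbb D(\operatorname{Ar}[n])$ such that (i) the restriction of $F$ to $i\to i$ is a zero object of $\mathbb D(e)$ for every $i$, and (ii) for all $i\le j\le k$ the restriction of $F$ to the square with corners $(i\to j),(i\to k),(j\to j),(j\to k)$ is cocartesian. Let $\mathsf S_{\bullet\bullet}\mathbb D$ be the bisimplicial set whose $(n,m)$-simplices are the objects $F$ of $\mathbb D([m]\times\operatorname{Ar}[n])$ whose underlying diagram $[m]\to\mathbb D(\operatorname{Ar}[n])$ sends all morphisms to isomorphisms and whose restriction along $\{a\}\times\operatorname{Ar}[n]$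 lies in $\mathsf s_n\mathbb D$ for every $a\in[m]$; the (bi)simplicial operators are given by inverse images. Its realization $|\mathsf S_{\bullet\bullet}\mathbb D|$ is the geometric realization of its diagonal. Put $$K^{W,\mathrm{ob}}(\mathbb D)=\Omega|\mathsf s_\bullet\mathbb D|,\qquad K^W(\mathbb D)=\Omega|\mathsf S_{\bullet\bullet}\mathbb D|.$$ The inclusion of the $0$-simplices in the second direction, $\mathsf s_n\mathbb D\cong\mathsf S_{n,0}\mathbb D\to\mathsf S_{n,m}\mathbb D$, which is the inverse image along the projection $[m]\times\operatorname{Ar}[n]\to\operatorname{Ar}[n]$, induces a map $|\mathsf s_\bullet\mathbb D|\to|\mathsf S_{\bullet\bullet}\mathbb D|$. Then, for every base point of $|\mathsf s_\bullet\mathbb D|$ and its image in $|\mathsf S_{\bullet\bullet}\mathbb D|$, the induced comparison map of loop spaces $$\iota\colon K^{W,\mathrm{ob}}(\mathbb D)\longrightarrow K^W(\mathbb D)$$ is a weak equivalence, i.e. it induces a bijection on path components and isomorphisms on all homotopy groups at all base points. -/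

import Mathlib

open CategoryTheory Opposite

universe w v u

namespace DerivatorKTheory

noncomputable section

/-! ### Finite posets as small categories -/

/-- A poset, regarded as a small category in the universe `w`. -/
def posetCat (P : Type) [PartialOrder P] : Cat.{w, w} :=
  @Cat.of (ULift.{w} P) (Preorder.smallCategory (ULift.{w} P))

/-- A monotone map, regarded as a functor. -/
def posetFunctor {P Q : Type} [PartialOrder P] [PartialOrder Q] (f : P →o Q) :
    posetCat.{w} P ⥤ posetCat.{w} Q :=
  Monotone.functor (X := ULift.{w} P) (Y := ULift.{w} Q) (f := fun x => ⟨f x.down⟩)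
    (fun _ _ h => f.monotone h)

/-- An inequality of monotone maps, regarded as a natural transformation. -/
def posetNatTrans {P Q : Type} [PartialOrder P] [PartialOrder Q] {f g : P →o Q} (h : f ≤ g) :
    posetFunctor.{w} f ⟶ posetFunctor.{w} g where
  app x := homOfLE (X := ULift.{w} Q) (h x.down)
  naturality _ _ _ := Subsingleton.elim (α := (ULift (PLift _))) _ _

/-- The final category `e`. -/
abbrev pointCat : Cat.{w, w} := posetCat.{w} Unit

/-- The functor `i_{X,x} : e ⥤ X` with value `x`. -/
abbrev pointFunctor (X : Cat.{w, w}) (x : X) : pointCat.{w} ⥤ X := (Functor.const _).obj x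

/-! ### Categories of diagrams and prederivators -/

/-- A `2`-category of diagrams: a (`1`- and `2`-)full sub-`2`-category of the `2`-category of small
categories (given by its objects) which contains the finite posets and is closed under opposites,
finite products, finite coproducts, and the comma categories `f ↓ y`. -/
structure DiagramCategory where
  mem : Cat.{w, w} → Prop
  mem_of_finite_poset : ∀ (P : Type w) [PartialOrder P] [Finite P], mem (Cat.of P)
  mem_op : ∀ X : Cat.{w, w}, mem X → mem (Cat.of Xᵒᵖ)
  mem_prod : ∀ X Y : Cat.{w, w}, mem X → mem Y → mem (Cat.of (X × Y))
  mem_sum : ∀ X Y : Cat.{w, w}, mem X → mem Y → mem (Cat.of (X ⊕ Y))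
  mem_comma : ∀ (X Y : Cat.{w, w}) (f : X ⥤ Y) (y : Y), mem X → mem Y →
    mem (Cat.of (Comma f (pointFunctor Y y)))

/-- The full sub-`2`-category of `Cat` spanned by the members of `Dia`. -/
abbrev DiagramCategory.Diagrams (Dia : DiagramCategory.{w}) :=
  Bicategory.InducedBicategory Cat.{w, w} (fun X : {X : Cat.{w, w} // Dia.mem X} => X.1)

/-- A member of `Dia` as an object of the `2`-category of diagrams. -/
abbrev DiagramCategory.mk' (Dia : DiagramCategory.{w}) (X : Cat.{w, w}) (hX : Dia.mem X) :
    Dia.Diagrams :=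
  (⟨X, hX⟩ : {X : Cat.{w, w} // Dia.mem X})

/-- The underlying small category of an object of `Dia`. -/
abbrev DiagramCategory.cat {Dia : DiagramCategory.{w}} (X : Dia.Diagrams) : Cat.{w, w} :=
  Subtype.val (p := Dia.mem) X

/-- A finite poset as an object of `Dia`. -/
abbrev DiagramCategory.poset (Dia : DiagramCategory.{w}) (P : Type) [PartialOrder P] [Finite P] :
    Dia.Diagrams :=
  Dia.mk' (posetCat.{w} P) (Dia.mem_of_finite_poset (ULift.{w} P))

/-- The disjoint union of two objects of `Dia`. -/
abbrev DiagramCategory.sum {Dia : DiagramCategory.{w}} (X Y : Dia.Diagrams) : Dia.Diagrams :=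
  Dia.mk' (Cat.of (DiagramCategory.cat X ⊕ DiagramCategory.cat Y)) (Dia.mem_sum _ _ X.2 Y.2)

/-- The comma category `f ↓ y` as an object of `Dia`. -/
abbrev DiagramCategory.comma {Dia : DiagramCategory.{w}} {X Y : Dia.Diagrams}
    (f : DiagramCategory.cat X ⥤ DiagramCategory.cat Y) (y : DiagramCategory.cat Y) :
    Dia.Diagrams :=
  Dia.mk' (Cat.of (Comma f (pointFunctor (DiagramCategory.cat Y) y)))
    (Dia.mem_comma _ _ f y X.2 Y.2)

open DiagramCategory (cat)

set_option linter.checkUnivs false in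
/-- A prederivator with domain `Dia`: a strict `2`-functor from `Dia` with reversed `1`-cells
to the `2`-category of categories. -/
abbrev Prederivator (Dia : DiagramCategory.{w}) :=
  StrictPseudofunctor (Dia.Diagrams)ᵒᵖ Cat.{v, u}

namespace Prederivator

variable {Dia : DiagramCategory.{w}} (D : Prederivator.{w, v, u} Dia)

/-- The category `𝔻(X)`. -/
abbrev at' (X : Dia.Diagrams) : Cat.{v, u} := D.obj (op X)

/-- The inverse image functor `f^* : 𝔻(Y) ⥤ 𝔻(X)`. -/
def pull {X Y : Dia.Diagrams} (f : cat X ⥤ cat Y) : D.at' Y ⥤ D.at' X :=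
  (D.map (Quiver.Hom.op (Bicategory.InducedBicategory.mkHom (X := X) (Y := Y)
    f.toCatHom))).toFunctor

/-- The natural transformation `α^* : f^* ⟶ g^*`. -/
def pull₂ {X Y : Dia.Diagrams} {f g : cat X ⥤ cat Y} (α : f ⟶ g) : D.pull f ⟶ D.pull g :=
  (D.map₂ (Bicategory.Opposite.op2 (Bicategory.InducedBicategory.mkHom₂
    (a := X) (b := Y) α.toCatHom₂))).toNatTrans

theorem pull_id (X : Dia.Diagrams) : D.pull (𝟭 (cat X)) = 𝟭 (D.at' X) :=
  congrArg Cat.Hom.toFunctor (D.map_id (op X))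

theorem pull_comp {X Y Z : Dia.Diagrams} (f : cat X ⥤ cat Y) (g : cat Y ⥤ cat Z) :
    D.pull (f ⋙ g) = D.pull g ⋙ D.pull f :=
  congrArg Cat.Hom.toFunctor (D.map_comp
    (Quiver.Hom.op (Bicategory.InducedBicategory.mkHom (X := Y) (Y := Z) g.toCatHom))
    (Quiver.Hom.op (Bicategory.InducedBicategory.mkHom (X := X) (Y := Y) f.toCatHom)))

theorem isIso_hom_comp_inv_iff {C : Type*} [Category C] {A A' B B' : C} (e : A ≅ A')
    (e' : B ≅ B') (φ : A' ⟶ B') : IsIso (e.hom ≫ φ ≫ e'.inv) ↔ IsIso φ := by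
  rw [isIso_comp_left_iff, isIso_comp_right_iff]

theorem isIso_pull₂_app_pull_iff {X Y Z : Dia.Diagrams} {f g : cat X ⥤ cat Y} (α : f ⟶ g)
    (k : cat Y ⥤ cat Z) (F : D.at' Z) :
    IsIso ((D.pull₂ (X := X) (Y := Z) (Functor.whiskerRight α k)).app F) ↔
      IsIso ((D.pull₂ α).app ((D.pull k).obj F)) := by
  let k' := Quiver.Hom.op (Bicategory.InducedBicategory.mkHom (X := Y) (Y := Z) k.toCatHom)
  let f' := Quiver.Hom.op (Bicategory.InducedBicategory.mkHom (X := X) (Y := Y) f.toCatHom)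
  let g' := Quiver.Hom.op (Bicategory.InducedBicategory.mkHom (X := X) (Y := Y) g.toCatHom)
  have h : (D.pull₂ (X := X) (Y := Z) (Functor.whiskerRight α k)).app F =
      ((Cat.Hom.toNatIso (D.mapComp k' f')).app F).hom ≫
        (D.pull₂ α).app ((D.pull k).obj F) ≫
        ((Cat.Hom.toNatIso (D.mapComp k' g')).app F).inv :=
    congrArg (fun t => t.toNatTrans.app F) (D.map₂_whisker_left k'
      (Bicategory.Opposite.op2 (Bicategory.InducedBicategory.mkHom₂
        (a := X) (b := Y) α.toCatHom₂)))
  rw [h]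
  exact isIso_hom_comp_inv_iff _ _ _

theorem isIso_pull₂_whiskerLeft_app {X Y Z : Dia.Diagrams} (k : cat X ⥤ cat Y)
    {f g : cat Y ⥤ cat Z} (α : f ⟶ g) (F : D.at' Z) (hα : IsIso ((D.pull₂ α).app F)) :
    IsIso ((D.pull₂ (X := X) (Y := Z) (Functor.whiskerLeft k α)).app F) := by
  let k' := Quiver.Hom.op (Bicategory.InducedBicategory.mkHom (X := X) (Y := Y) k.toCatHom)
  let f' := Quiver.Hom.op (Bicategory.InducedBicategory.mkHom (X := Y) (Y := Z) f.toCatHom)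
  let g' := Quiver.Hom.op (Bicategory.InducedBicategory.mkHom (X := Y) (Y := Z) g.toCatHom)
  have h : (D.pull₂ (X := X) (Y := Z) (Functor.whiskerLeft k α)).app F =
      ((Cat.Hom.toNatIso (D.mapComp f' k')).app F).hom ≫
        (D.pull k).map ((D.pull₂ α).app F) ≫
        ((Cat.Hom.toNatIso (D.mapComp g' k')).app F).inv :=
    congrArg (fun t => t.toNatTrans.app F) (D.map₂_whisker_right
      (Bicategory.Opposite.op2 (Bicategory.InducedBicategory.mkHom₂
        (a := Y) (b := Z) α.toCatHom₂)) k')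
  rw [h]
  have h' : IsIso ((D.pull k).map ((D.pull₂ α).app F)) := inferInstance
  exact (isIso_hom_comp_inv_iff _ _ _).2 h'

theorem isIso_pull₂_id_app {X Y : Dia.Diagrams} (f : cat X ⥤ cat Y) (F : D.at' Y) :
    IsIso ((D.pull₂ (𝟙 f)).app F) := by
  have h : D.pull₂ (𝟙 f) = 𝟙 (D.pull f) := congrArg Cat.Hom₂.toNatTrans (D.map₂_id
    (Quiver.Hom.op (Bicategory.InducedBicategory.mkHom (X := X) (Y := Y) f.toCatHom)))
  rw [h]
  infer_instance

/-- The category `𝔻(P)` for a finite poset `P`. -/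
abbrev atPoset (P : Type) [PartialOrder P] [Finite P] : Cat.{v, u} := D.at' (Dia.poset P)

/-- The inverse image functor along a monotone map of finite posets. -/
def pullPoset {P Q : Type} [PartialOrder P] [Finite P] [PartialOrder Q] [Finite Q] (f : P →o Q) :
    D.atPoset Q ⥤ D.atPoset P :=
  D.pull (X := Dia.poset P) (Y := Dia.poset Q) (posetFunctor.{w} f)

/-- The natural transformation of inverse images induced by an inequality of monotone maps. -/
def pullPoset₂ {P Q : Type} [PartialOrder P] [Finite P] [PartialOrder Q] [Finite Q]
    {f g : P →o Q} (h : f ≤ g) : D.pullPoset f ⟶ D.pullPoset g :=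
  D.pull₂ (X := Dia.poset P) (Y := Dia.poset Q) (posetNatTrans.{w} h)

theorem pullPoset_id_obj {P : Type} [PartialOrder P] [Finite P] (F : D.atPoset P) :
    (D.pullPoset OrderHom.id).obj F = F :=
  Functor.congr_obj (D.pull_id (Dia.poset P)) F

theorem pullPoset_comp {P Q R : Type} [PartialOrder P] [Finite P] [PartialOrder Q] [Finite Q]
    [PartialOrder R] [Finite R] (f : P →o Q) (g : Q →o R) :
    D.pullPoset (g.comp f) = D.pullPoset g ⋙ D.pullPoset f :=
  D.pull_comp (X := Dia.poset P) (Y := Dia.poset Q) (Z := Dia.poset R)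
    (posetFunctor.{w} f) (posetFunctor.{w} g)

theorem pullPoset_comp_obj {P Q R : Type} [PartialOrder P] [Finite P] [PartialOrder Q] [Finite Q]
    [PartialOrder R] [Finite R] (f : P →o Q) (g : Q →o R) (F : D.atPoset R) :
    (D.pullPoset (g.comp f)).obj F = (D.pullPoset f).obj ((D.pullPoset g).obj F) :=
  Functor.congr_obj (D.pullPoset_comp f g) F

/-- The fiber `F_x = i_{X,x}^* F` as a functor `𝔻(X) ⥤ 𝔻(e)`. -/
def fiber (X : Dia.Diagrams) (x : cat X) : D.at' X ⥤ D.atPoset Unit :=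
  D.pull (X := Dia.poset Unit) (Y := X) (pointFunctor (cat X) x)

/-! ### Pointed right derivators -/

/-- The natural transformation `j^* f^* ⟶ p^* i_y^*` obtained by applying `𝔻` to the comma square
of `f : X ⥤ Y` and an object `y` of `Y`, where `j : f ↓ y ⥤ X` and `p : f ↓ y ⥤ e` are the
projections. -/
def commaTrans {X Y : Dia.Diagrams} (f : cat X ⥤ cat Y) (y : cat Y) :
    D.pull f ⋙ D.pull (X := DiagramCategory.comma f y) (Y := X)
        (Comma.fst f (pointFunctor (cat Y) y)) ⟶
      D.fiber Y y ⋙ D.pull (X := DiagramCategory.comma f y) (Y := Dia.poset Unit)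
        (Comma.snd f (pointFunctor (cat Y) y)) :=
  eqToHom (D.pull_comp _ _).symm ≫
    D.pull₂ (X := DiagramCategory.comma f y) (Y := Y)
      (Comma.natTrans f (pointFunctor (cat Y) y)) ≫
    eqToHom (D.pull_comp (X := DiagramCategory.comma f y) (Y := Dia.poset Unit) (Z := Y) _ _)

/-- The Beck--Chevalley transformation `c_{f,y} : p_! j^* ⟶ i_y^* f_!`, the mate of
`j^* f^* ⟶ p^* i_y^*`. -/
def beckChevalley {X Y : Dia.Diagrams} (f : cat X ⥤ cat Y) (y : cat Y)
    {fSh : D.at' X ⥤ D.at' Y} (adj : fSh ⊣ D.pull f)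
    {pSh : D.at' (DiagramCategory.comma f y) ⥤ D.atPoset Unit}
    (adj' : pSh ⊣ D.pull (X := DiagramCategory.comma f y) (Y := Dia.poset Unit)
      (Comma.snd f (pointFunctor (cat Y) y))) :
    D.pull (X := DiagramCategory.comma f y) (Y := X) (Comma.fst f (pointFunctor (cat Y) y)) ⋙ pSh ⟶
      fSh ⋙ D.fiber Y y :=
  ((mateEquiv adj adj').symm (TwoSquare.mk _ _ _ _ (D.commaTrans f y))).natTrans

/-- `𝔻` is a right derivator: the axioms (Der1)--(Der4). -/
structure IsRightDerivator : Prop where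
  /-- `𝔻(X ⊔ Y) ⟶ 𝔻(X) × 𝔻(Y)` is an equivalence. -/
  der1_sum : ∀ X Y : Dia.Diagrams,
    (Functor.prod' (D.pull (X := X) (Y := DiagramCategory.sum X Y) (Sum.inl_ (cat X) (cat Y)))
      (D.pull (X := Y) (Y := DiagramCategory.sum X Y) (Sum.inr_ (cat X) (cat Y)))).IsEquivalence
  /-- `𝔻(∅)` is the final category. -/
  der1_empty : ((Functor.const (D.atPoset Empty)).obj (⟨⟨⟩⟩ : Discrete PUnit.{1})).IsEquivalence
  der2 : ∀ (X : Dia.Diagrams) {F G : D.at' X} (φ : F ⟶ G),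
    (∀ x : cat X, IsIso ((D.fiber X x).map φ)) → IsIso φ
  /-- Every `f^*` has a left adjoint `f_!`. -/
  der3 : ∀ {X Y : Dia.Diagrams} (f : cat X ⥤ cat Y), (D.pull f).IsRightAdjoint
  /-- The Beck--Chevalley condition for comma squares. -/
  der4 : ∀ {X Y : Dia.Diagrams} (f : cat X ⥤ cat Y) (y : cat Y)
    {fSh : D.at' X ⥤ D.at' Y} (adj : fSh ⊣ D.pull f)
    {pSh : D.at' (DiagramCategory.comma f y) ⥤ D.atPoset Unit}
    (adj' : pSh ⊣ D.pull (X := DiagramCategory.comma f y) (Y := Dia.poset Unit)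
      (Comma.snd f (pointFunctor (cat Y) y))),
    IsIso (D.beckChevalley f y adj adj')

/-- `𝔻` is pointed: every `𝔻(X)` has a zero object, and every `f^*` preserves zero objects. -/
structure IsPointed : Prop where
  hasZeroObject : ∀ X : Dia.Diagrams, Limits.HasZeroObject (D.at' X)
  isZero_pull : ∀ {X Y : Dia.Diagrams} (f : cat X ⥤ cat Y) (F : D.at' Y),
    Limits.IsZero F → Limits.IsZero ((D.pull f).obj F)

/-- A pointed right derivator. -/
structure IsPointedRightDerivator : Prop extends D.IsRightDerivator, D.IsPointed

/-! ### Cocartesian squares -/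

/-- The square `□ = [1] × [1]`. -/
abbrev Square : Type := Fin 2 × Fin 2

/-- The corner `⌜ ⊆ □`, obtained by removing `(1,1)`. -/
abbrev Corner : Type := {p : Square // p ≠ (1, 1)}

/-- The inclusion of the corner in the square. -/
def cornerIncl : Corner →o Square := OrderHom.Subtype.val _

/-- A square `F` in `𝔻(□)` is cocartesian if the counit `(i_⌜)_! (i_⌜)^* F ⟶ F` is an isomorphism
(for one, equivalently for every, left adjoint `(i_⌜)_!` of `(i_⌜)^*`). -/
def IsCocartesian (F : D.atPoset Square) : Prop :=
  ∃ (L : D.atPoset Corner ⥤ D.atPoset Square) (adj : L ⊣ D.pullPoset cornerIncl),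
    IsIso (adj.counit.app F)

end Prederivator

/-! ### Posets of arrows -/

/-- The poset of arrows `Ar[n]`: its elements are the arrows `i ⟶ j` of `[n]`, with the order
`(i ⟶ j) ≤ (i' ⟶ j')` if and only if `i ≤ i'` and `j ≤ j'`. -/
abbrev Ar (n : SimplexCategory) : Type :=
  {p : Fin (n.len + 1) × Fin (n.len + 1) // p.1 ≤ p.2}

/-- The functoriality of `Ar[n]` in `[n]`. -/
def Ar.map {k n : SimplexCategory} (θ : k ⟶ n) : Ar k →o Ar n where
  toFun p := ⟨(θ.toOrderHom p.1.1, θ.toOrderHom p.1.2), θ.toOrderHom.monotone p.2⟩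
  monotone' _ _ h := ⟨θ.toOrderHom.monotone h.1, θ.toOrderHom.monotone h.2⟩

/-- The inclusion of the object `i ⟶ i` in `Ar[n]`. -/
def Ar.diagPoint (n : SimplexCategory) (i : Fin (n.len + 1)) : Unit →o Ar n :=
  OrderHom.const _ ⟨(i, i), le_rfl⟩

/-- The square
```
(i ⟶ j) → (i ⟶ k)
   ↓         ↓
(j ⟶ j) → (j ⟶ k)
```
in `Ar[n]`; the first coordinate of `□` is the horizontal one. -/
def Ar.square (n : SimplexCategory) {i j k : Fin (n.len + 1)} (hij : i ≤ j) (hjk : j ≤ k) :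
    Prederivator.Square →o Ar n where
  toFun p := ⟨(if p.2 = 0 then i else j, if p.1 = 0 then j else k), by
    dsimp only; split_ifs <;>
      first | (exact le_rfl) | assumption | (exact hij.trans hjk)⟩
  monotone' p q h := by
    obtain ⟨h₁, h₂⟩ := h
    refine ⟨?_, ?_⟩ <;> dsimp only <;> split_ifs <;>
      first | (exact le_rfl) | assumption | (exfalso; omega)

/-! ### Weak equivalences and loop spaces -/

section Topological

variable {X Y : Type*} [TopologicalSpace X] [TopologicalSpace Y]

/-- The map induced by a continuous map on sets of path components. -/
def mapPi0 (f : C(X, Y)) : ZerothHomotopy X → ZerothHomotopy Y :=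
  Quotient.map f (fun _ _ h => Nonempty.map (fun γ => Path.map γ f.continuous) h)

/-- The map induced by a continuous map on generalized loops. -/
def mapGenLoop (f : C(X, Y)) {N : Type*} (x : X) (γ : GenLoop N X x) : GenLoop N Y (f x) :=
  ⟨f.comp γ.1, fun y hy => congrArg f (γ.2 y hy)⟩

/-- The map induced by a continuous map on the `n`-th homotopy groups. -/
def mapPi (f : C(X, Y)) (n : ℕ) (x : X) : HomotopyGroup.Pi n X x → HomotopyGroup.Pi n Y (f x) :=
  Quotient.map (mapGenLoop f x) (fun _ _ h => h.map fun H => H.compContinuousMap f)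

/-- A weak (homotopy) equivalence of topological spaces: a continuous map that induces a bijection
on path components and, for every base point, on all homotopy groups. -/
def IsWeakEquivalence (f : C(X, Y)) : Prop :=
  Function.Bijective (mapPi0 f) ∧ ∀ (n : ℕ) (x : X), Function.Bijective (mapPi f n x)

/-- The map `Ω f : Ω(X, x) ⟶ Ω(Y, f x)` of loop spaces (with the compact-open topology). -/
def loopMap (f : C(X, Y)) (x : X) : C(LoopSpace X x, LoopSpace Y (f x)) where
  toFun γ := γ.map f.continuous
  continuous_toFun := by
    rw [continuous_induced_rng]
    exact (ContinuousMap.continuous_postcomp f).comp continuous_induced_dom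

end Topological

namespace Prederivator

variable {Dia : DiagramCategory.{w}} (D : Prederivator.{w, v, u} Dia)

/-! ### The `s_•`-construction -/

/-- The condition on an object `F` of `𝔻(Ar[n])` to be in the full subcategory `S_n 𝔻`. -/
structure IsS (n : SimplexCategory) (F : D.atPoset (Ar n)) : Prop where
  zero : ∀ i : Fin (n.len + 1), Limits.IsZero ((D.pullPoset (Ar.diagPoint n i)).obj F)
  cocartesian : ∀ {i j k : Fin (n.len + 1)} (hij : i ≤ j) (hjk : j ≤ k),
    D.IsCocartesian ((D.pullPoset (Ar.square n hij hjk)).obj F)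

theorem IsS.pull {D : Prederivator.{w, v, u} Dia} {k n : SimplexCategory} (θ : k ⟶ n)
    {F : D.atPoset (Ar n)} (hF : D.IsS n F) : D.IsS k ((D.pullPoset (Ar.map θ)).obj F) where
  zero i := by
    rw [← D.pullPoset_comp_obj]
    exact hF.zero (θ.toOrderHom i)
  cocartesian {i j l} hij hjl := by
    rw [← D.pullPoset_comp_obj]
    have h : (Ar.map θ).comp (Ar.square k hij hjl) =
        Ar.square n (θ.toOrderHom.monotone hij) (θ.toOrderHom.monotone hjl) := by
      ext p : 3
      exact Prod.ext (apply_ite θ.toOrderHom _ _ _) (apply_ite θ.toOrderHom _ _ _)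
    rw [h]
    exact hF.cocartesian _ _

/-- The simplicial set `s_• 𝔻` with `s_n 𝔻 = Ob S_n 𝔻`. -/
def sConstruction : SSet.{u} where
  obj n := {F : D.atPoset (Ar n.unop) // D.IsS n.unop F}
  map θ := ↾fun F => ⟨(D.pullPoset (Ar.map θ.unop)).obj F.1, F.2.pull θ.unop⟩
  map_id n := by
    refine ConcreteCategory.hom_ext _ _ fun F => ?_
    exact Subtype.ext (D.pullPoset_id_obj F.1)
  map_comp θ η := by
    refine ConcreteCategory.hom_ext _ _ fun F => ?_
    exact Subtype.ext (D.pullPoset_comp_obj (Ar.map η.unop) (Ar.map θ.unop) F.1)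

/-! ### The `S_••`-construction -/

/-- The inclusion `a × P : P ⟶ Y × P` of the slice at `a`. -/
def slice {Y : Type} (P : Type) [PartialOrder Y] [PartialOrder P] (a : Y) : P →o Y × P where
  toFun x := (a, x)
  monotone' _ _ h := ⟨le_rfl, h⟩

theorem slice_le_slice {Y P : Type} [PartialOrder Y] [PartialOrder P] {a b : Y} (h : a ≤ b) :
    slice P a ≤ slice P b :=
  fun _ => ⟨h, le_rfl⟩

/-- An object `F` of `𝔻(Y × P)` is in `𝔻(Y × P)_eq` if its underlying diagram `Y ⥤ 𝔻(P)` sends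
each morphism `a ≤ b` of `Y` to an isomorphism `(a × P)^* F ⟶ (b × P)^* F`. -/
def IsEq (Y P : Type) [PartialOrder Y] [Finite Y] [PartialOrder P] [Finite P]
    (F : D.atPoset (Y × P)) : Prop :=
  ∀ {a b : Y} (h : a ≤ b), IsIso ((D.pullPoset₂ (slice_le_slice (P := P) h)).app F)

/-- The condition on an object `F` of `𝔻([m] × Ar[n])` to be an `(n,m)`-simplex of `S_•• 𝔻`. -/
structure IsSBi (n m : SimplexCategory) (F : D.atPoset (Fin (m.len + 1) × Ar n)) : Prop where
  isEq : D.IsEq (Fin (m.len + 1)) (Ar n) F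
  isS : ∀ a : Fin (m.len + 1), D.IsS n ((D.pullPoset (slice (Ar n) a)).obj F)

/-- The map of posets `[m'] × Ar[n'] ⟶ [m] × Ar[n]` induced by `[n'] ⟶ [n]` and `[m'] ⟶ [m]`. -/
def biMap {n' n m' m : SimplexCategory} (θ : n' ⟶ n) (η : m' ⟶ m) :
    Fin (m'.len + 1) × Ar n' →o Fin (m.len + 1) × Ar n :=
  OrderHom.prodMap η.toOrderHom (Ar.map θ)

theorem IsSBi.pull {D : Prederivator.{w, v, u} Dia} {n' n m' m : SimplexCategory}
    (θ : n' ⟶ n) (η : m' ⟶ m) {F : D.atPoset (Fin (m.len + 1) × Ar n)} (hF : D.IsSBi n m F) :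
    D.IsSBi n' m' ((D.pullPoset (biMap θ η)).obj F) where
  isEq {a b} h := by
    have h₁ := hF.isEq (η.toOrderHom.monotone h)
    have h₂ := D.isIso_pull₂_whiskerLeft_app (X := Dia.poset (Ar n')) (Y := Dia.poset (Ar n))
      (Z := Dia.poset (Fin (m.len + 1) × Ar n)) (posetFunctor.{w} (Ar.map θ))
      (posetNatTrans.{w} (slice_le_slice (P := Ar n) (η.toOrderHom.monotone h))) F h₁
    exact (D.isIso_pull₂_app_pull_iff (X := Dia.poset (Ar n'))
      (Y := Dia.poset (Fin (m'.len + 1) × Ar n')) (Z := Dia.poset (Fin (m.len + 1) × Ar n))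
      (posetNatTrans.{w} (slice_le_slice (P := Ar n') h)) (posetFunctor.{w} (biMap θ η)) F).1 h₂
  isS a := by
    have h : (biMap θ η).comp (slice (Ar n') a) =
      (slice (Ar n) (η.toOrderHom a)).comp (Ar.map θ) := rfl
    rw [← D.pullPoset_comp_obj, h, D.pullPoset_comp_obj]
    exact (hF.isS _).pull θ

/-- The bisimplicial set `S_•• 𝔻`; its value at `([n], [m])` is the set `S_{n,m} 𝔻`. -/
def SBi : SimplexCategoryᵒᵖ × SimplexCategoryᵒᵖ ⥤ Type u where
  obj x := {F : D.atPoset (Fin (x.2.unop.len + 1) × Ar x.1.unop) // D.IsSBi x.1.unop x.2.unop F}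
  map θ := ↾fun F => ⟨(D.pullPoset (biMap θ.1.unop θ.2.unop)).obj F.1, F.2.pull θ.1.unop θ.2.unop⟩
  map_id x := by
    refine ConcreteCategory.hom_ext _ _ fun F => ?_
    exact Subtype.ext (D.pullPoset_id_obj F.1)
  map_comp θ η := by
    refine ConcreteCategory.hom_ext _ _ fun F => ?_
    exact Subtype.ext (D.pullPoset_comp_obj (biMap η.1.unop η.2.unop)
      (biMap θ.1.unop θ.2.unop) F.1)

/-- The diagonal simplicial set of `S_•• 𝔻`, whose realization is `|S_•• 𝔻|`. -/
def diagSBi : SSet.{u} := Functor.diag SimplexCategoryᵒᵖ ⋙ D.SBi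

/-! ### The comparison map -/

/-- The projection `[m] × Ar[n] ⟶ Ar[n]`, which for `m = 0` is the isomorphism that identifies
`s_n 𝔻` with `S_{n,0} 𝔻`. -/
def arProj (n m : SimplexCategory) : Fin (m.len + 1) × Ar n →o Ar n := OrderHom.snd

theorem IsS.const {D : Prederivator.{w, v, u} Dia} (n m : SimplexCategory)
    {F : D.atPoset (Ar n)} (hF : D.IsS n F) : D.IsSBi n m ((D.pullPoset (arProj n m)).obj F) where
  isEq {a b} h := by
    refine (D.isIso_pull₂_app_pull_iff (X := Dia.poset (Ar n))
      (Y := Dia.poset (Fin (m.len + 1) × Ar n)) (Z := Dia.poset (Ar n))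
      (posetNatTrans.{w} (slice_le_slice (P := Ar n) h)) (posetFunctor.{w} (arProj n m)) F).1 ?_
    exact D.isIso_pull₂_id_app (X := Dia.poset (Ar n)) (Y := Dia.poset (Ar n))
      (posetFunctor.{w} OrderHom.id) F
  isS a := by
    have h : (arProj n m).comp (slice (Ar n) a) = OrderHom.id := rfl
    rw [← D.pullPoset_comp_obj, h, D.pullPoset_id_obj]
    exact hF

/-- The inclusion of the `0`-simplices in the second direction: the map of bisimplicial sets
to `S_•• 𝔻` from `s_• 𝔻 = S_{•,0} 𝔻`, constant in the second direction, which is given by the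
iterated degeneracies `S_{n,0} 𝔻 ⟶ S_{n,m} 𝔻`. -/
def inclBi : CategoryTheory.Prod.fst SimplexCategoryᵒᵖ SimplexCategoryᵒᵖ ⋙ D.sConstruction ⟶
    D.SBi where
  app x := ↾fun F => ⟨(D.pullPoset (arProj x.1.unop x.2.unop)).obj F.1, F.2.const _ _⟩
  naturality x y θ := by
    refine ConcreteCategory.hom_ext _ _ fun F => ?_
    exact Subtype.ext ((D.pullPoset_comp_obj (arProj y.1.unop y.2.unop)
      (Ar.map θ.1.unop) F.1).symm.trans (D.pullPoset_comp_obj (biMap θ.1.unop θ.2.unop)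
      (arProj x.1.unop x.2.unop) F.1))

/-- The map of simplicial sets `s_• 𝔻 ⟶ diag S_•• 𝔻` induced on diagonals by the inclusion
of the `0`-simplices. -/
def incl : D.sConstruction ⟶ D.diagSBi :=
  Functor.whiskerLeft (Functor.diag SimplexCategoryᵒᵖ) D.inclBi

/-- The space `K^{W,ob}(𝔻) = Ω|s_• 𝔻|` of loops at the base point `b`. -/
abbrev KWob (b : SSet.toTop.obj D.sConstruction) : Type u := LoopSpace (SSet.toTop.obj D.sConstruction) b

/-- The Waldhausen `K`-theory space `K^W(𝔻) = Ω|S_•• 𝔻|` of loops at the base point `b`. -/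
abbrev KW (b : SSet.toTop.obj D.diagSBi) : Type u := LoopSpace (SSet.toTop.obj D.diagSBi) b

/-- The map `|s_• 𝔻| ⟶ |S_•• 𝔻|` of realizations given by the inclusion of the `0`-simplices. -/
def inclRealization : C(SSet.toTop.obj D.sConstruction, SSet.toTop.obj D.diagSBi) := (SSet.toTop.map D.incl).hom

/-- The comparison map `ι : K^{W,ob}(𝔻) ⟶ K^W(𝔻)` at a base point `b` of `|s_• 𝔻|`. -/
def comparison (b : SSet.toTop.obj D.sConstruction) : C(D.KWob b, D.KW (D.inclRealization b)) :=
  loopMap D.inclRealization b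

end Prederivator

end

end DerivatorKTheory

/-!
The inclusion `s_• 𝔻 ⟶ diag S_•• 𝔻` is the inclusion of a strong deformation retract, already at the
level of simplicial sets.

An `n`-simplex of the diagonal is an object `F` of `𝔻([n] × Ar[n])` which is constant up to
isomorphism in the direction of `[n]`. As isomorphisms are detected on fibers (`der2`), the
restrictions of `F` to the graphs of all monotone maps `Ar[n] ⟶ [n]` are isomorphic to its
restriction to a slice (`IsEq.isIso_graph`), and the conditions that define `s_•` are invariant
under isomorphisms. Hence `F` may be restricted to these graphs, with result in `s_n 𝔻`, and along
every monotone map `[n] × Ar[n] ⟶ [n] × Ar[n]` over `Ar[n]` (`IsSBi.isS_graph`,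
`IsSBi.pull_graph`). The map `(i ⟶ j) ↦ j` is natural in `[n]`, so the restriction to its graph is a
simplicial retraction `retr`. After composition with the inclusion it becomes the restriction along
`(x, i ⟶ j) ↦ (j, i ⟶ j)`. This map and the identity both lie below
`(x, i ⟶ j) ↦ (max x j, i ⟶ j)`, and a comparison of natural families of monotone maps yields a
simplicial homotopy (`NaturalMap.homotopy`). The homotopies take place over `Ar[n]`, so they are
stationary on `s_• 𝔻`.

To realize such a homotopy, the prism `|Δⁿ| × [0, 1]` is mapped to the order complex of
`[n] × [1]`, naturally in `[n]` (`prismWeight`), and a family of simplices indexed by the chains of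
a finite poset is realized as a continuous map on the order complex
(`ChainFamily.exists_continuousMap`). The maps on the prisms glue to a map from the realization to
a space of paths, by the adjunction between realization and singular simplicial sets
(`SimplicialHomotopy.homotopicRel_toTop`). Finally, a strong deformation retraction induces one on
spaces of loops at a base point of the retract, and so a weak equivalence
(`isWeakEquivalence_loopMap`).
-/

namespace DerivatorKTheory

/-! ### Strong deformation retracts and loop spaces -/

section DeformationRetract

open scoped unitInterval

variable {X Y : Type*} [TopologicalSpace X] [TopologicalSpace Y]

/-- The inclusion of a strong deformation retract is a weak equivalence. Because the homotopy is
stationary on the image of `i`, no change of base point is needed. -/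
theorem IsWeakEquivalence.of_homotopicRel (i : C(X, Y)) (r : C(Y, X)) (hr : ∀ x, r (i x) = x)
    (h : (ContinuousMap.id Y).HomotopicRel (i.comp r) (Set.range i)) : IsWeakEquivalence i := by
  obtain ⟨H⟩ := h
  refine ⟨⟨?_, ?_⟩, fun n x => ⟨?_, ?_⟩⟩
  · rintro ⟨a⟩ ⟨b⟩ hab
    obtain ⟨γ⟩ := Quotient.exact hab
    exact Quotient.sound ⟨(γ.map r.continuous).cast (hr a).symm (hr b).symm⟩
  · rintro ⟨y⟩
    exact ⟨Quotient.mk _ (r y), Quotient.sound ⟨(H.toHomotopy.evalAt y).symm⟩⟩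
  · rintro ⟨α⟩ ⟨β⟩ hab
    obtain ⟨K⟩ := Quotient.exact hab
    have e (δ : GenLoop (Fin n) X x) : r.comp (mapGenLoop i x δ).1 = δ.1 :=
      ContinuousMap.ext fun y => hr (δ.1 y)
    exact Quotient.sound ⟨(K.compContinuousMap r).cast (e α) (e β)⟩
  · rintro ⟨β⟩
    have hβ (y) (hy : y ∈ Cube.boundary (Fin n)) : β.1 y = i x := β.2 y hy
    let α : GenLoop (Fin n) X x := ⟨r.comp β.1, fun y hy => by simp [hβ y hy, hr]⟩
    refine ⟨Quotient.mk _ α, Quotient.sound ⟨?_⟩⟩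
    exact ContinuousMap.HomotopyRel.symm
      { toHomotopy := H.toHomotopy.compContinuousMap β.1
        prop' := fun t y hy => by
          have := H.eq_fst t (x := β.1 y) ⟨x, (hβ y hy).symm⟩
          exact this }

/-- If `i` is the inclusion of a strong deformation retract, then so is the map which it induces
on loop spaces. -/
theorem isWeakEquivalence_loopMap (i : C(X, Y)) (r : C(Y, X)) (hr : ∀ x, r (i x) = x)
    (h : (ContinuousMap.id Y).HomotopicRel (i.comp r) (Set.range i)) (b : X) :
    IsWeakEquivalence (loopMap i b) := by
  obtain ⟨H⟩ := h
  have H_range (t : I) (x : X) : H (t, i x) = i x := H.eq_fst t ⟨x, rfl⟩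
  have ev : Continuous fun q : LoopSpace Y (i b) × I => q.1 q.2 := by fun_prop
  let ρ : C(LoopSpace Y (i b), LoopSpace X b) :=
    { toFun γ := (γ.map r.continuous).cast (hr b).symm (hr b).symm
      continuous_toFun := by
        rw [continuous_induced_rng]
        exact (ContinuousMap.continuous_postcomp r).comp continuous_induced_dom }
  refine IsWeakEquivalence.of_homotopicRel (loopMap i b) ρ ?_ ⟨?_⟩
  · intro γ
    ext t
    exact hr (γ t)
  · exact
      { toFun q :=
          { toFun s := H (q.1, q.2 s)
            continuous_toFun := by fun_prop
            source' := by simp [H_range]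
            target' := by simp [H_range] }
        continuous_toFun := by
          rw [continuous_induced_rng]
          refine ContinuousMap.continuous_of_continuous_uncurry _ ?_
          change Continuous fun q : (I × LoopSpace Y (i b)) × I => H (q.1.1, q.1.2 q.2)
          fun_prop
        map_zero_left γ := by
          ext s
          exact H.apply_zero (γ s)
        map_one_left γ := by
          ext s
          exact H.apply_one (γ s)
        prop' := by
          rintro t _ ⟨γ, rfl⟩
          ext s
          exact H_range t (γ s) }

end DeformationRetract

/-! ### Weights on finite sets -/

section Weights

open scoped unitInterval

variable {α β : Type*} [Fintype α] [Fintype β]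

theorem stdSimplex_sum_map [DecidableEq β] (f : α → β) (q : stdSimplex ℝ α) (s : Finset β) :
    ∑ y ∈ s, stdSimplex.map f q y = ∑ x with f x ∈ s, q x := by
  classical
  simp only [stdSimplex.map_coe, FunOnFinite.linearMap_apply_apply]
  rw [← Finset.sum_fiberwise_of_maps_to (s := Finset.univ.filter fun x => f x ∈ s) (t := s)
    (g := f) (by simp)]
  refine Finset.sum_congr rfl fun y hy => Finset.sum_congr ?_ fun _ _ => rfl
  ext x
  simp only [Finset.mem_filter, Finset.mem_univ, true_and]
  exact ⟨fun h => ⟨h ▸ hy, h⟩, fun h => h.2⟩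

theorem stdSimplex_map_apply [DecidableEq β] (f : α → β) (q : stdSimplex ℝ α) (y : β) :
    stdSimplex.map f q y = ∑ x with f x = y, q x := by
  simpa using stdSimplex_sum_map f q {y}

theorem stdSimplex_map_congr {f g : α → β} (q : stdSimplex ℝ α)
    (h : ∀ x, q x ≠ 0 → f x = g x) : stdSimplex.map f q = stdSimplex.map g q := by
  classical
  refine stdSimplex.ext (funext fun y => ?_)
  rw [stdSimplex_map_apply, stdSimplex_map_apply, Finset.sum_filter, Finset.sum_filter]
  refine Finset.sum_congr rfl fun x _ => ?_
  by_cases hx : q x = 0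
  · simp [hx]
  · rw [h x hx]

theorem stdSimplex_map_apply_ne_zero (f : α → β) (q : stdSimplex ℝ α) {x : α} (hx : q x ≠ 0) :
    stdSimplex.map f q (f x) ≠ 0 := by
  classical
  rw [stdSimplex_map_apply]
  have : q x ≤ ∑ z with f z = f x, q z :=
    Finset.single_le_sum (f := fun z => q z) (fun z _ => stdSimplex.zero_le q z) (by simp)
  exact (((stdSimplex.zero_le q x).lt_of_ne' hx).trans_le this).ne'

theorem exists_of_stdSimplex_map_apply_ne_zero (f : α → β) (q : stdSimplex ℝ α) {y : β}
    (hy : stdSimplex.map f q y ≠ 0) : ∃ x, f x = y := by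
  classical
  rw [stdSimplex_map_apply] at hy
  obtain ⟨x, hx, -⟩ := Finset.exists_ne_zero_of_sum_ne_zero hy
  exact ⟨x, by simpa using hx⟩

theorem stdSimplex_map_map_invFun [Nonempty α] (f : α → β) (q : stdSimplex ℝ β)
    (h : ∀ y, q y ≠ 0 → ∃ x, f x = y) :
    stdSimplex.map f (stdSimplex.map (Function.invFun f) q) = q := by
  rw [stdSimplex.map_comp_apply]
  conv_rhs => rw [← stdSimplex.map_id_apply q]
  exact stdSimplex_map_congr q fun y hy => Function.invFun_eq (h y hy)

theorem exists_stdSimplex_apply_ne_zero (q : stdSimplex ℝ α) : ∃ x, q x ≠ 0 := by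
  by_contra! h
  simpa [h] using stdSimplex.sum_eq_one q

end Weights

/-! ### Chains in finite posets and points of a realization -/

section Chains

variable {P : Type} [PartialOrder P]

theorem exists_orderEmbedding_range_eq (s : Finset P) (hs : IsChain (· ≤ ·) (s : Set P))
    (hne : s.Nonempty) : ∃ (n : SimplexCategory) (e : Fin (n.len + 1) ↪o P),
      Set.range e = s ∧ n.len + 1 = s.card := by
  classical
  let _ : LinearOrder s := hs.linearOrder
  obtain ⟨m, hm⟩ := Nat.exists_eq_succ_of_ne_zero hne.card_pos.ne'
  let e := monoEquivOfFin s (k := m + 1) (by simpa using hm)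
  refine ⟨SimplexCategory.mk m, e.toOrderEmbedding.trans ⟨⟨Subtype.val, Subtype.val_injective⟩,
    Iff.rfl⟩, ?_, hm.symm⟩
  ext x
  constructor
  · rintro ⟨i, rfl⟩
    exact (e i).2
  · intro hx
    exact ⟨e.symm ⟨x, hx⟩, congrArg Subtype.val (e.apply_symm_apply ⟨x, hx⟩)⟩

variable (P) in
/-- A map from the nerve of the poset `P` to the simplicial set `Y`: a simplex of `Y` for each
chain in `P`, with possible repetitions, compatible with the simplicial operators. -/
structure ChainFamily (Y : SSet.{u}) where
  simplex {n : SimplexCategory} (c : Fin (n.len + 1) →o P) : Y.obj (op n)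
  map_simplex {n m : SimplexCategory} (θ : m ⟶ n) (c : Fin (n.len + 1) →o P) :
    Y.map θ.op (simplex c) = simplex (c.comp θ.toOrderHom)

/-- The continuous map `|Δⁿ| ⟶ |Y|` corresponding to an `n`-simplex of `Y`. -/
noncomputable def simplexMap {Y : SSet.{u}} {n : SimplexCategory} (y : Y.obj (op n)) :
    C(stdSimplex ℝ (Fin (n.len + 1)), SSet.toTop.obj Y) :=
  TopCat.toSSetObjEquiv _ (op n) ((sSetTopAdj.unit.app Y).app (op n) y)

theorem simplexMap_map {Y : SSet.{u}} {n m : SimplexCategory} (θ : m ⟶ n) (y : Y.obj (op n))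
    (q : stdSimplex ℝ (Fin (m.len + 1))) :
    simplexMap (Y.map θ.op y) q = simplexMap y (stdSimplex.map θ.toOrderHom q) := by
  have h := ConcreteCategory.congr_hom ((sSetTopAdj.unit.app Y).naturality θ.op) y
  exact congrArg (fun z => TopCat.toSSetObjEquiv _ (op m) z q) h

theorem toTop_map_simplexMap {X Y : SSet.{u}} (f : X ⟶ Y) {n : SimplexCategory} (x : X.obj (op n))
    (q : stdSimplex ℝ (Fin (n.len + 1))) :
    (SSet.toTop.map f).hom (simplexMap x q) = simplexMap (f.app (op n) x) q := by
  have h := ConcreteCategory.congr_hom (NatTrans.congr_app (sSetTopAdj.unit.naturality f) (op n)) x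
  exact (congrArg (fun z => TopCat.toSSetObjEquiv _ (op n) z q) h).symm

theorem continuousMap_ext_of_simplexMap {X : SSet.{u}} {T : Type u} [TopologicalSpace T]
    {f g : C(SSet.toTop.obj X, T)}
    (h : ∀ (n : SimplexCategory) (x : X.obj (op n)) (q : stdSimplex ℝ (Fin (n.len + 1))),
      f (simplexMap x q) = g (simplexMap x q)) : f = g := by
  suffices TopCat.ofHom f = TopCat.ofHom g from congrArg TopCat.Hom.hom this
  refine (sSetTopAdj.homEquiv X (TopCat.of T)).injective ?_
  ext n x
  refine (TopCat.toSSetObjEquiv (TopCat.of T) n).injective (ContinuousMap.ext fun q => ?_)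
  exact h n.unop x q

/-- A compatible family of continuous maps on the topological simplices indexed by the simplices of
`X` glues to a continuous map on the realization of `X`. -/
theorem exists_continuousMap_of_simplexMap {X : SSet.{u}} {T : Type u} [TopologicalSpace T]
    (φ : ∀ {n : SimplexCategory}, X.obj (op n) → C(stdSimplex ℝ (Fin (n.len + 1)), T))
    (hφ : ∀ {n m : SimplexCategory} (θ : m ⟶ n) (x : X.obj (op n)) (q),
      φ (X.map θ.op x) q = φ x (stdSimplex.map θ.toOrderHom q)) :
    ∃ f : C(SSet.toTop.obj X, T), ∀ {n : SimplexCategory} (x : X.obj (op n)) (q),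
      f (simplexMap x q) = φ x q := by
  let ψ : X ⟶ TopCat.toSSet.obj (TopCat.of T) :=
    { app n := ↾fun x => (TopCat.toSSetObjEquiv (TopCat.of T) n).symm (φ x)
      naturality n m θ := by
        refine ConcreteCategory.hom_ext _ _ fun x => ?_
        refine (TopCat.toSSetObjEquiv (TopCat.of T) m).injective (ContinuousMap.ext fun q => ?_)
        exact hφ θ.unop x q }
  refine ⟨((sSetTopAdj.homEquiv X (TopCat.of T)).symm ψ).hom, fun {n} x q => ?_⟩
  have h := (sSetTopAdj.homEquiv X (TopCat.of T)).apply_symm_apply ψ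
  have h' := ConcreteCategory.congr_hom (NatTrans.congr_app h (op n)) x
  exact congrArg (fun z => TopCat.toSSetObjEquiv (TopCat.of T) (op n) z q) h'

variable [Fintype P] {Y : SSet.{u}} (y : ChainFamily P Y)

/-- A weight that is pushed forward along a chain can be represented on every nondegenerate chain
that contains its support. -/
theorem ChainFamily.simplexMap_eq {n m : SimplexCategory} (c : Fin (n.len + 1) →o P)
    (q : stdSimplex ℝ (Fin (n.len + 1))) (e : Fin (m.len + 1) ↪o P)
    (he : ∀ x, stdSimplex.map c q x ≠ 0 → ∃ i, e i = x) :
    simplexMap (y.simplex c) q =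
      simplexMap (y.simplex (n := m) (e : Fin (m.len + 1) →o P))
        (stdSimplex.map (Function.invFun e) (stdSimplex.map c q)) := by
  classical
  -- Restrict `c` to the support of `q`, where it factors through `e`.
  obtain ⟨l, δ, hδ, -⟩ := exists_orderEmbedding_range_eq
    (Finset.univ.filter fun i => q i ≠ 0) (fun a _ b _ _ => le_total a b)
    (by obtain ⟨i, hi⟩ := exists_stdSimplex_apply_ne_zero q; exact ⟨i, by simpa using hi⟩)
  have hδq (i) : q i ≠ 0 ↔ ∃ a, δ a = i := by
    simpa using (Set.ext_iff.1 hδ i).symm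
  have hπ (a) : e (Function.invFun e (c (δ a))) = c (δ a) :=
    Function.invFun_eq (he _ (stdSimplex_map_apply_ne_zero c q ((hδq _).2 ⟨a, rfl⟩)))
  let θ : l ⟶ n := SimplexCategory.Hom.mk δ
  let π : l ⟶ m := SimplexCategory.Hom.mk
    { toFun a := Function.invFun e (c (δ a))
      monotone' a b hab := by
        rw [← e.le_iff_le, hπ, hπ]
        exact c.monotone (δ.monotone hab) }
  have hθπ : c.comp θ.toOrderHom = OrderHom.comp (e : Fin (m.len + 1) →o P) π.toOrderHom :=
    OrderHom.ext _ _ (funext fun a => (hπ a).symm)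
  have hq := stdSimplex_map_map_invFun δ q fun i hi => (hδq i).1 hi
  generalize stdSimplex.map (Function.invFun δ) q = q' at hq
  calc simplexMap (y.simplex c) q = simplexMap (y.simplex c) (stdSimplex.map θ.toOrderHom q') :=
        congrArg _ hq.symm
    _ = simplexMap (y.simplex (OrderHom.comp (e : Fin (m.len + 1) →o P) π.toOrderHom)) q' := by
        rw [← simplexMap_map, y.map_simplex, hθπ]
    _ = simplexMap (y.simplex (n := m) (e : Fin (m.len + 1) →o P))
          (stdSimplex.map π.toOrderHom q') := by
        rw [← y.map_simplex, simplexMap_map]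
    _ = _ := by
        rw [← hq, stdSimplex.map_comp_apply, stdSimplex.map_comp_apply]
        rfl

variable (P) in
/-- The weights on `P` whose support is a chain: the points of the order complex of `P`. -/
abbrev ChainWeights : Type :=
  {w : stdSimplex ℝ P // IsChain (· ≤ ·) {x | w x ≠ 0}}

theorem isChain_support_map {n : ℕ} (c : Fin n →o P) (q : stdSimplex ℝ (Fin n)) :
    IsChain (· ≤ ·) {x | stdSimplex.map c q x ≠ 0} := by
  intro x hx x' hx' _
  obtain ⟨i, rfl⟩ := exists_of_stdSimplex_map_apply_ne_zero c q hx
  obtain ⟨j, rfl⟩ := exists_of_stdSimplex_map_apply_ne_zero c q hx'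
  exact (le_total i j).imp (fun h => c.monotone h) fun h => c.monotone h

theorem exists_orderEmbedding_range_support (w : ChainWeights P) :
    ∃ (n : SimplexCategory) (e : Fin (n.len + 1) ↪o P),
      (∀ x, w.1 x ≠ 0 → ∃ i, e i = x) ∧ n.len < Fintype.card P := by
  classical
  obtain ⟨n, e, he, hn⟩ := exists_orderEmbedding_range_eq (Finset.univ.filter fun x => w.1 x ≠ 0)
    (by simpa using w.2)
    (by obtain ⟨i, hi⟩ := exists_stdSimplex_apply_ne_zero w.1; exact ⟨i, by simpa using hi⟩)
  refine ⟨n, e, fun x hx => ?_, ?_⟩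
  · have := (Set.ext_iff.1 he x).2 (by simpa using hx)
    exact this
  · have := Finset.card_le_univ (Finset.univ.filter fun x => w.1 x ≠ 0)
    omega

variable (P) in
/-- The nondegenerate simplices of the nerve of `P`, together with some degenerate ones. -/
abbrev ShortChain : Type :=
  Σ k : Fin (Fintype.card P), Fin (k.1 + 1) →o P

instance : Finite (ShortChain P) :=
  have (k : Fin (Fintype.card P)) : Finite (Fin (k.1 + 1) →o P) := DFunLike.finite _
  inferInstance

/-- The point of the order complex given by a weight on a chain. -/
noncomputable def chainWeightsMap (i : ShortChain P) (q : stdSimplex ℝ (Fin (i.1.1 + 1))) :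
    ChainWeights P :=
  ⟨stdSimplex.map i.2 q, isChain_support_map _ _⟩

theorem continuous_chainWeightsMap (i : ShortChain P) : Continuous (chainWeightsMap i) :=
  (stdSimplex.continuous_map _).subtype_mk _

/-- The order complex of a finite poset is a quotient of a finite union of topological simplices,
since it is Hausdorff and the union is compact. -/
theorem isQuotientMap_chainWeightsMap :
    Topology.IsQuotientMap
      fun a : (Σ i : ShortChain P, stdSimplex ℝ (Fin (i.1.1 + 1))) => chainWeightsMap a.1 a.2 := by
  have hc : Continuous
      fun a : (Σ i : ShortChain P, stdSimplex ℝ (Fin (i.1.1 + 1))) => chainWeightsMap a.1 a.2 :=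
    continuous_sigma fun i => continuous_chainWeightsMap i
  refine hc.isClosedMap.isQuotientMap hc fun w => ?_
  obtain ⟨n, e, he, hn⟩ := exists_orderEmbedding_range_support w
  exact ⟨⟨⟨⟨n.len, hn⟩, (e : Fin (n.len + 1) →o P)⟩, stdSimplex.map (Function.invFun e) w.1⟩,
    Subtype.ext (stdSimplex_map_map_invFun _ _ he)⟩

/-- A map from the nerve of a finite poset `P` to `Y` induces a continuous map from the order
complex of `P` to the realization of `Y`. -/
theorem ChainFamily.exists_continuousMap :
    ∃ g : C(ChainWeights P, SSet.toTop.obj Y),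
      ∀ {n : SimplexCategory} (c : Fin (n.len + 1) →o P) (q : stdSimplex ℝ (Fin (n.len + 1)))
        (w : ChainWeights P), stdSimplex.map c q = w.1 → g w = simplexMap (y.simplex c) q := by
  classical
  choose N e he _ using exists_orderEmbedding_range_support (P := P)
  obtain ⟨g, hg⟩ : ∃ g : ChainWeights P → SSet.toTop.obj Y,
      ∀ {n : SimplexCategory} (c : Fin (n.len + 1) →o P) (q : stdSimplex ℝ (Fin (n.len + 1)))
        (w : ChainWeights P), stdSimplex.map c q = w.1 → g w = simplexMap (y.simplex c) q := by
    refine ⟨fun w => simplexMap (y.simplex (n := N w) (e w : Fin ((N w).len + 1) →o P))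
      (stdSimplex.map (Function.invFun (e w)) w.1), fun c q w hw => ?_⟩
    rw [y.simplexMap_eq c q (e w) (by rw [hw]; exact he w), hw]
  refine ⟨⟨g, isQuotientMap_chainWeightsMap.continuous_iff.2 (continuous_sigma fun i => ?_)⟩, hg⟩
  refine (simplexMap (y.simplex (n := SimplexCategory.mk i.1.1) i.2)).continuous.congr fun q => ?_
  exact (hg (n := SimplexCategory.mk i.1.1) i.2 q _ rfl).symm

end Chains

/-! ### The prism decomposition -/

section Prism

open scoped unitInterval

theorem sum_prod_fin_two {α : Type} [Fintype α] (g : α × Fin 2 → ℝ) :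
    ∑ x, g x = ∑ a, (g (a, 0) + g (a, 1)) := by
  simp [Fintype.sum_prod_type, Fin.sum_univ_two]

variable {α β : Type} [Fintype α] [LinearOrder α] [Fintype β] [LinearOrder β]

/-- Lay the weights `p a` end to end as intervals in `[0, 1]`: this is the length of the part of the
interval of `a` which lies to the left of `1 - t`. -/
def lowerWeight (p : stdSimplex ℝ α) (t : I) (a : α) : ℝ :=
  min (∑ x with x ≤ a, p x) (1 - t) - min (∑ x with x < a, p x) (1 - t)

theorem sum_le_eq_add_sum_lt (p : stdSimplex ℝ α) (a : α) :
    ∑ x with x ≤ a, p x = p a + ∑ x with x < a, p x := by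
  have h : (Finset.univ.filter fun x => x ≤ a) =
      insert a (Finset.univ.filter fun x => x < a) := by
    ext x
    simp [le_iff_eq_or_lt]
  rw [h, Finset.sum_insert (by simp)]

theorem lowerWeight_nonneg (p : stdSimplex ℝ α) (t : I) (a : α) : 0 ≤ lowerWeight p t a := by
  rw [lowerWeight, sum_le_eq_add_sum_lt, sub_nonneg]
  exact min_le_min_right _ (le_add_of_nonneg_left (stdSimplex.zero_le p a))

theorem lowerWeight_le (p : stdSimplex ℝ α) (t : I) (a : α) : lowerWeight p t a ≤ p a := by
  have := stdSimplex.zero_le p a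
  rw [lowerWeight, sum_le_eq_add_sum_lt]
  grind

/-- The sum telescopes: the intervals of the elements of a lower set form an initial segment of
`[0, 1]`. -/
theorem sum_lowerWeight (p : stdSimplex ℝ α) (t : I) (s : Finset α)
    (hs : IsLowerSet (s : Set α)) :
    ∑ a ∈ s, lowerWeight p t a = min (∑ a ∈ s, p a) (1 - t) := by
  induction s using Finset.induction_on_max with
  | empty => simpa using t.2.2
  | insert a s ha ih =>
    have hs' : s = Finset.univ.filter fun x => x < a := by
      ext x
      simp only [Finset.mem_filter, Finset.mem_univ, true_and]
      refine ⟨ha x, fun hx => ?_⟩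
      have := hs hx.le (by simp : a ∈ (↑(insert a s) : Set α))
      simpa [hx.ne] using this
    have h' : a ∉ s := fun h => lt_irrefl a (ha a h)
    rw [Finset.sum_insert h', Finset.sum_insert h', ih, lowerWeight, sum_le_eq_add_sum_lt, ← hs']
    · ring
    · rw [hs']
      intro x y hyx hx
      simpa using hyx.trans_lt (by simpa using hx)

theorem lowerWeight_map (f : α →o β) (p : stdSimplex ℝ α) (t : I) (b : β) :
    lowerWeight (stdSimplex.map f p) t b = ∑ a with f a = b, lowerWeight p t a := by
  have h (a : α) : f a ≤ b ↔ f a = b ∨ f a < b := le_iff_eq_or_lt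
  have h₁ := sum_lowerWeight p t (Finset.univ.filter fun a => f a ≤ b)
    (fun x y hyx hx => by simpa using (f.monotone hyx).trans (by simpa using hx))
  have h₂ := sum_lowerWeight p t (Finset.univ.filter fun a => f a < b)
    (fun x y hyx hx => by simpa using (f.monotone hyx).trans_lt (by simpa using hx))
  simp only [h, Finset.filter_or] at h₁
  rw [Finset.sum_union (Finset.disjoint_filter.2 fun a _ h h' => h'.ne h), h₂,
    ← Finset.filter_or] at h₁
  rw [lowerWeight, stdSimplex_sum_map, stdSimplex_sum_map]
  simp only [Finset.mem_filter, Finset.mem_univ, true_and, h]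
  linarith

/-- The point of the prism `|α| × [0, 1]`, in the barycentric coordinates of the triangulation of
the prism by the chains in `α × [1]`. -/
def prismWeight (p : stdSimplex ℝ α) (t : I) : stdSimplex ℝ (α × Fin 2) :=
  ⟨fun x => if x.2 = 0 then lowerWeight p t x.1 else p x.1 - lowerWeight p t x.1, by
    refine ⟨fun x => ?_, ?_⟩
    · dsimp only
      split_ifs
      · exact lowerWeight_nonneg p t x.1
      · exact sub_nonneg.2 (lowerWeight_le p t x.1)
    · rw [sum_prod_fin_two]
      simp⟩

theorem prismWeight_apply_zero (p : stdSimplex ℝ α) (t : I) (a : α) :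
    prismWeight p t (a, 0) = lowerWeight p t a := rfl

theorem prismWeight_apply_one (p : stdSimplex ℝ α) (t : I) (a : α) :
    prismWeight p t (a, 1) = p a - lowerWeight p t a := rfl

/-- If the interval of `a` reaches to the left of `1 - t` and that of `b` to the right of it, then
`a ≤ b`. -/
theorem isChain_support_prismWeight (p : stdSimplex ℝ α) (t : I) :
    IsChain (· ≤ ·) {x | prismWeight p t x ≠ 0} := by
  have key (a b : α) (ha : prismWeight p t (a, 0) ≠ 0) (hb : prismWeight p t (b, 1) ≠ 0) :
      a ≤ b := by
    by_contra! h
    rw [prismWeight_apply_zero, lowerWeight] at ha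
    rw [prismWeight_apply_one, lowerWeight] at hb
    have h₁ : ∑ x with x ≤ b, p x ≤ ∑ x with x < a, p x :=
      Finset.sum_le_sum_of_subset_of_nonneg
        (fun x => by simpa using fun hx : x ≤ b => hx.trans_lt h)
        fun x _ _ => stdSimplex.zero_le p x
    have h₂ := sum_le_eq_add_sum_lt p a
    have h₃ := sum_le_eq_add_sum_lt p b
    have h₄ := stdSimplex.zero_le p a
    have h₅ := stdSimplex.zero_le p b
    grind
  rintro ⟨a, i⟩ ha ⟨b, j⟩ hb -
  fin_cases i <;> fin_cases j
  · exact (le_total a b).imp (fun h => ⟨h, le_rfl⟩) fun h => ⟨h, le_rfl⟩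
  · exact Or.inl ⟨key a b ha hb, Fin.zero_le _⟩
  · exact Or.inr ⟨key b a hb ha, Fin.zero_le _⟩
  · exact (le_total a b).imp (fun h => ⟨h, le_rfl⟩) fun h => ⟨h, le_rfl⟩

theorem prismWeight_map (f : α →o β) (p : stdSimplex ℝ α) (t : I) :
    prismWeight (stdSimplex.map f p) t = stdSimplex.map (Prod.map f id) (prismWeight p t) := by
  refine stdSimplex.ext (funext fun ⟨b, j⟩ => ?_)
  rw [stdSimplex_map_apply, Finset.sum_filter, sum_prod_fin_two]
  fin_cases j
  · simp [prismWeight_apply_zero, lowerWeight_map, Finset.sum_filter]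
  · have := stdSimplex_map_apply f p b
    simp only [Fin.mk_one, prismWeight_apply_one, lowerWeight_map, this]
    simp only [Finset.sum_filter, ← Finset.sum_sub_distrib]
    refine Finset.sum_congr rfl fun a _ => ?_
    by_cases h : f a = b <;> simp [h]

theorem prismWeight_zero (p : stdSimplex ℝ α) :
    prismWeight p 0 = stdSimplex.map (fun a => (a, 0)) p := by
  have h (s : Finset α) : ∑ x ∈ s, p x ≤ 1 := by
    rw [← stdSimplex.sum_eq_one p]
    exact Finset.sum_le_sum_of_subset_of_nonneg (Finset.subset_univ s)
      fun x _ _ => stdSimplex.zero_le p x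
  have h' (a : α) : lowerWeight p 0 a = p a := by
    simp [lowerWeight, h, sum_le_eq_add_sum_lt p a ▸ h (Finset.univ.filter fun x => x ≤ a),
      sum_le_eq_add_sum_lt]
  refine stdSimplex.ext (funext fun ⟨b, j⟩ => ?_)
  rw [stdSimplex_map_apply, Finset.sum_filter]
  fin_cases j
  · simp [prismWeight_apply_zero, h']
  · simp [prismWeight_apply_one, h']

theorem prismWeight_one (p : stdSimplex ℝ α) :
    prismWeight p 1 = stdSimplex.map (fun a => (a, 1)) p := by
  have h (s : Finset α) : 0 ≤ ∑ x ∈ s, p x :=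
    Finset.sum_nonneg fun x _ => stdSimplex.zero_le p x
  have h' (a : α) : lowerWeight p 1 a = 0 := by
    simp [lowerWeight, h]
  refine stdSimplex.ext (funext fun ⟨b, j⟩ => ?_)
  rw [stdSimplex_map_apply, Finset.sum_filter]
  fin_cases j
  · simp [prismWeight_apply_zero, h']
  · simp [prismWeight_apply_one, h']

theorem map_fst_prismWeight (p : stdSimplex ℝ α) (t : I) :
    stdSimplex.map Prod.fst (prismWeight p t) = p := by
  refine stdSimplex.ext (funext fun b => ?_)
  rw [stdSimplex_map_apply, Finset.sum_filter, sum_prod_fin_two]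
  rw [Finset.sum_eq_single b (fun a _ ha => by simp [ha]) (by simp)]
  simp [prismWeight_apply_zero, prismWeight_apply_one]

theorem continuous_prismWeight :
    Continuous fun q : stdSimplex ℝ α × I => prismWeight q.1 q.2 := by
  have hev (a : α) : Continuous fun q : stdSimplex ℝ α × I => q.1 a :=
    (continuous_apply a).comp (continuous_subtype_val.comp continuous_fst)
  have hw (a : α) : Continuous fun q : stdSimplex ℝ α × I => lowerWeight q.1 q.2 a := by
    unfold lowerWeight
    fun_prop
  refine Continuous.subtype_mk (continuous_pi fun x => ?_) _
  by_cases hx : x.2 = 0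
  · simpa [hx] using hw x.1
  · simp only [hx, if_false]
    exact (hev x.1).sub (hw x.1)

end Prism

/-! ### Realization of simplicial homotopies -/

section RealizationHomotopy

open scoped unitInterval

variable {A X Y : SSet.{u}}

/-- A simplicial homotopy from `f` to `g`, that is, a map `X × Δ¹ ⟶ Y` which restricts to `f` and
`g` at the ends of `Δ¹`, spelled out on simplices: an `n`-simplex of `Δ¹` is a monotone map
`[n] ⟶ [1]`. -/
structure SimplicialHomotopy (f g : X ⟶ Y) where
  h {n : SimplexCategory} (x : X.obj (op n)) (a : Fin (n.len + 1) →o Fin 2) : Y.obj (op n)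
  map_h {n m : SimplexCategory} (θ : m ⟶ n) (x : X.obj (op n)) (a : Fin (n.len + 1) →o Fin 2) :
    Y.map θ.op (h x a) = h (X.map θ.op x) (a.comp θ.toOrderHom)
  h_zero {n : SimplexCategory} (x : X.obj (op n)) : h x (OrderHom.const _ 0) = f.app (op n) x
  h_one {n : SimplexCategory} (x : X.obj (op n)) : h x (OrderHom.const _ 1) = g.app (op n) x

namespace SimplicialHomotopy

variable {f g : X ⟶ Y} (H : SimplicialHomotopy f g)

/-- The map from the prism `Δⁿ × Δ¹`, which is the nerve of `[n] × [1]`, to `Y` given by the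
restriction of a simplicial homotopy to an `n`-simplex of `X`. -/
def chainFamily {n : SimplexCategory} (x : X.obj (op n)) :
    ChainFamily (Fin (n.len + 1) × Fin 2) Y where
  simplex {k} c :=
    H.h (X.map (Quiver.Hom.op (SimplexCategory.Hom.mk (OrderHom.fst.comp c) : k ⟶ n)) x)
      (OrderHom.snd.comp c)
  map_simplex {k l} θ c := by
    rw [H.map_h, ← Functor.map_comp_apply]
    rfl

theorem chainFamily_map {n m k : SimplexCategory} (θ : m ⟶ n) (x : X.obj (op n))
    (c : Fin (k.len + 1) →o Fin (m.len + 1) × Fin 2) :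
    (H.chainFamily (X.map θ.op x)).simplex c =
      (H.chainFamily x).simplex ((OrderHom.prodMap θ.toOrderHom OrderHom.id).comp c) := by
  change H.h _ _ = H.h _ _
  rw [← Functor.map_comp_apply]
  rfl

theorem exists_chain_prismWeight {n : SimplexCategory} (p : stdSimplex ℝ (Fin (n.len + 1)))
    (t : I) : ∃ (k : SimplexCategory) (c : Fin (k.len + 1) →o Fin (n.len + 1) × Fin 2)
      (q : stdSimplex ℝ (Fin (k.len + 1))), stdSimplex.map c q = prismWeight p t := by
  obtain ⟨k, e, he, -⟩ :=
    exists_orderEmbedding_range_support ⟨prismWeight p t, isChain_support_prismWeight p t⟩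
  exact ⟨k, e, _, stdSimplex_map_map_invFun e _ he⟩

/-- The realization of a simplicial homotopy, glued from the prisms over the simplices of `X`. -/
theorem exists_continuousMap : ∃ F : C(SSet.toTop.obj X, C(I, SSet.toTop.obj Y)),
    ∀ {n k : SimplexCategory} (x : X.obj (op n)) (p : stdSimplex ℝ (Fin (n.len + 1))) (t : I)
      (c : Fin (k.len + 1) →o Fin (n.len + 1) × Fin 2) (q : stdSimplex ℝ (Fin (k.len + 1))),
      stdSimplex.map c q = prismWeight p t →
        F (simplexMap x p) t = simplexMap ((H.chainFamily x).simplex c) q := by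
  choose G hG using fun (n : SimplexCategory) (x : X.obj (op n)) =>
    (H.chainFamily x).exists_continuousMap
  let π (n : SimplexCategory) :
      C(stdSimplex ℝ (Fin (n.len + 1)) × I, ChainWeights (Fin (n.len + 1) × Fin 2)) :=
    ⟨fun q => ⟨prismWeight q.1 q.2, isChain_support_prismWeight _ _⟩,
      continuous_prismWeight.subtype_mk _⟩
  obtain ⟨F, hF⟩ := exists_continuousMap_of_simplexMap
    (fun {n} (x : X.obj (op n)) => ((G n x).comp (π n)).curry) (by
      intro n m θ x p
      refine ContinuousMap.ext fun t => ?_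
      obtain ⟨k, c, q, hc⟩ := exists_chain_prismWeight p t
      refine (hG m _ c q (π m (p, t)) hc).trans ?_
      rw [chainFamily_map]
      refine (hG n x _ q (π n (_, t)) ?_).symm
      refine Eq.trans ?_ (prismWeight_map θ.toOrderHom p t).symm
      rw [← hc, stdSimplex.map_comp_apply]
      rfl)
  refine ⟨F, fun {n k} x p t c q hc => ?_⟩
  rw [hF]
  exact hG n x c q (π n (p, t)) hc

/-- Geometric realization turns a simplicial homotopy that is stationary on the image of `i` into a
homotopy that is stationary on the image of the realization of `i`. -/
theorem homotopicRel_toTop (i : A ⟶ X)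
    (hi : ∀ {n : SimplexCategory} (z : A.obj (op n)) (a : Fin (n.len + 1) →o Fin 2),
      H.h (i.app (op n) z) a = f.app (op n) (i.app (op n) z)) :
    (SSet.toTop.map f).hom.HomotopicRel (SSet.toTop.map g).hom
      (Set.range (SSet.toTop.map i).hom) := by
  obtain ⟨F, hF⟩ := H.exists_continuousMap
  have h_end (ε : Fin 2) {n : SimplexCategory} (x : X.obj (op n)) :
      (H.chainFamily x).simplex (OrderHom.prod OrderHom.id (OrderHom.const _ ε)) =
        H.h x (OrderHom.const _ ε) := by
    change H.h (X.map (𝟙 (op n)) x) _ = _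
    rw [Functor.map_id_apply]
    rfl
  have hF₀ : (⟨fun z => F z 0, by fun_prop⟩ : C(SSet.toTop.obj X, SSet.toTop.obj Y)) =
      (SSet.toTop.map f).hom := by
    refine continuousMap_ext_of_simplexMap fun n x q => ?_
    refine (hF x q 0 (OrderHom.prod OrderHom.id (OrderHom.const _ 0)) q
      (prismWeight_zero q).symm).trans ?_
    rw [h_end, H.h_zero, toTop_map_simplexMap]
  have hF₁ : (⟨fun z => F z 1, by fun_prop⟩ : C(SSet.toTop.obj X, SSet.toTop.obj Y)) =
      (SSet.toTop.map g).hom := by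
    refine continuousMap_ext_of_simplexMap fun n x q => ?_
    refine (hF x q 1 (OrderHom.prod OrderHom.id (OrderHom.const _ 1)) q
      (prismWeight_one q).symm).trans ?_
    rw [h_end, H.h_one, toTop_map_simplexMap]
  have hFi : F.comp (SSet.toTop.map i).hom =
      (ContinuousMap.const' (X := I)).comp
        ((SSet.toTop.map f).hom.comp (SSet.toTop.map i).hom) := by
    refine continuousMap_ext_of_simplexMap fun n z p => ContinuousMap.ext fun t => ?_
    obtain ⟨k, c, q, hc⟩ := exists_chain_prismWeight p t
    simp only [ContinuousMap.comp_apply, toTop_map_simplexMap]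
    rw [hF _ p t c q hc]
    change simplexMap (H.h (X.map _ (i.app (op n) z)) _) q = simplexMap _ p
    rw [← NatTrans.naturality_apply, hi, NatTrans.naturality_apply, NatTrans.naturality_apply,
      simplexMap_map]
    have hp := map_fst_prismWeight p t
    rw [← hc, stdSimplex.map_comp_apply] at hp
    conv_rhs => rw [← hp]
    rfl
  exact
    ⟨{ toFun q := F q.2 q.1
       map_zero_left z := congrArg (fun k : C(_, _) => k z) hF₀
       map_one_left z := congrArg (fun k : C(_, _) => k z) hF₁
       prop' := by
        rintro t _ ⟨z, rfl⟩
        exact congrArg (fun k : C(_, C(I, _)) => k z t) hFi }⟩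

end SimplicialHomotopy

end RealizationHomotopy

open DiagramCategory (cat)

namespace Prederivator

variable {Dia : DiagramCategory.{w}} {D : Prederivator.{w, v, u} Dia}

/-! ### Diagrams that are constant up to isomorphism in one direction -/

theorem isIso_pull₂_whiskerLeft_app_iff {X Y Z : Dia.Diagrams} (k : cat X ⥤ cat Y)
    {f g : cat Y ⥤ cat Z} (α : f ⟶ g) (F : D.at' Z) :
    IsIso ((D.pull₂ (X := X) (Y := Z) (Functor.whiskerLeft k α)).app F) ↔
      IsIso ((D.pull k).map ((D.pull₂ α).app F)) := by
  let k' := Quiver.Hom.op (Bicategory.InducedBicategory.mkHom (X := X) (Y := Y) k.toCatHom)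
  let f' := Quiver.Hom.op (Bicategory.InducedBicategory.mkHom (X := Y) (Y := Z) f.toCatHom)
  let g' := Quiver.Hom.op (Bicategory.InducedBicategory.mkHom (X := Y) (Y := Z) g.toCatHom)
  have h : (D.pull₂ (X := X) (Y := Z) (Functor.whiskerLeft k α)).app F =
      ((Cat.Hom.toNatIso (D.mapComp f' k')).app F).hom ≫
        (D.pull k).map ((D.pull₂ α).app F) ≫
        ((Cat.Hom.toNatIso (D.mapComp g' k')).app F).inv :=
    congrArg (fun t => t.toNatTrans.app F) (D.map₂_whisker_right
      (Bicategory.Opposite.op2 (Bicategory.InducedBicategory.mkHom₂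
        (a := Y) (b := Z) α.toCatHom₂)) k')
  rw [h]
  exact isIso_hom_comp_inv_iff _ _ _

theorem graph_le_graph {Y P : Type} [PartialOrder Y] [PartialOrder P] {u v : P →o Y} (h : u ≤ v) :
    u.prod OrderHom.id ≤ v.prod OrderHom.id :=
  fun x => ⟨h x, le_rfl⟩

/-- By `der2` it is enough to look at the fibers, where the morphism in question is one of those
that the definition of `IsEq` requires to be invertible. -/
theorem IsEq.isIso_graph {Y P : Type} [PartialOrder Y] [Finite Y] [PartialOrder P] [Finite P]
    (hD : D.IsRightDerivator) {F : D.atPoset (Y × P)} (hF : D.IsEq Y P F) {u v : P →o Y}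
    (h : u ≤ v) : IsIso ((D.pullPoset₂ (graph_le_graph h)).app F) := by
  refine hD.der2 (Dia.poset P) _ fun x => ?_
  refine (isIso_pull₂_whiskerLeft_app_iff (X := Dia.poset Unit) (Y := Dia.poset P)
    (Z := Dia.poset (Y × P)) (pointFunctor (posetCat P) x)
    (posetNatTrans.{w} (graph_le_graph h)) F).1 ?_
  exact D.isIso_pull₂_whiskerLeft_app (X := Dia.poset Unit) (Y := Dia.poset P)
    (Z := Dia.poset (Y × P)) (pointFunctor (posetCat P) x)
    (posetNatTrans.{w} (slice_le_slice (P := P) (h x.down))) F (hF (h x.down))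

theorem IsCocartesian.of_iso {F G : D.atPoset Square} (hF : D.IsCocartesian F) (e : F ≅ G) :
    D.IsCocartesian G := by
  obtain ⟨L, adj, h⟩ := hF
  exact ⟨L, adj, (NatTrans.isIso_app_iff_of_iso adj.counit e).1 h⟩

theorem IsS.of_iso {n : SimplexCategory} {F G : D.atPoset (Ar n)} (hF : D.IsS n F) (e : F ≅ G) :
    D.IsS n G where
  zero i := (hF.zero i).of_iso ((D.pullPoset (Ar.diagPoint n i)).mapIso e.symm)
  cocartesian hij hjk :=
    (hF.cocartesian hij hjk).of_iso ((D.pullPoset (Ar.square n hij hjk)).mapIso e)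

/-- All restrictions of an `(n, m)`-simplex to graphs of monotone maps `Ar[n] ⟶ [m]` are isomorphic,
hence inherit the defining conditions from the restriction to a slice. -/
theorem IsSBi.isS_graph (hD : D.IsRightDerivator) {n m : SimplexCategory}
    {F : D.atPoset (Fin (m.len + 1) × Ar n)} (hF : D.IsSBi n m F) (u : Ar n →o Fin (m.len + 1)) :
    D.IsS n ((D.pullPoset (u.prod OrderHom.id)).obj F) := by
  have h : OrderHom.const _ 0 ≤ u := fun x => Fin.zero_le _
  have h' := IsEq.isIso_graph hD hF.isEq h
  exact (hF.isS 0).of_iso (@asIso _ _ _ _ _ h')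

/-- The bisimplicial set `S_••` admits inverse images along all maps over `Ar[n]`, not only along
the simplicial operators in the second direction. -/
theorem IsSBi.pull_graph (hD : D.IsRightDerivator) {n m m' : SimplexCategory}
    {F : D.atPoset (Fin (m.len + 1) × Ar n)} (hF : D.IsSBi n m F)
    (u : Fin (m'.len + 1) × Ar n →o Fin (m.len + 1)) :
    D.IsSBi n m' ((D.pullPoset (u.prod OrderHom.snd)).obj F) where
  isEq {a b} h := by
    have h' : u.comp (slice (Ar n) a) ≤ u.comp (slice (Ar n) b) :=
      fun x => u.monotone ⟨h, le_rfl⟩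
    exact (D.isIso_pull₂_app_pull_iff (X := Dia.poset (Ar n))
      (Y := Dia.poset (Fin (m'.len + 1) × Ar n)) (Z := Dia.poset (Fin (m.len + 1) × Ar n))
      (posetNatTrans.{w} (slice_le_slice (P := Ar n) h))
      (posetFunctor.{w} (u.prod OrderHom.snd)) F).1 (IsEq.isIso_graph hD hF.isEq h')
  isS a := by
    rw [← D.pullPoset_comp_obj]
    exact hF.isS_graph hD (u.comp (slice (Ar n) a))

/-! ### The deformation retraction -/

/-- The map `(i ⟶ j) ↦ j` from `Ar[n]` to `[n]`. -/
def arTarget (n : SimplexCategory) : Ar n →o Fin (n.len + 1) :=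
  OrderHom.snd.comp (OrderHom.Subtype.val _)

variable (D) in
/-- The retraction of the diagonal of `S_••` onto `s_•`: the restriction of a diagram on
`[n] × Ar[n]` to the graph of the map `(i ⟶ j) ↦ j`. -/
def retr (hD : D.IsRightDerivator) : D.diagSBi ⟶ D.sConstruction where
  app n := ↾fun F => ⟨(D.pullPoset ((arTarget n.unop).prod OrderHom.id)).obj F.1,
    F.2.isS_graph hD _⟩
  naturality n m θ := by
    refine ConcreteCategory.hom_ext _ _ fun F => ?_
    exact Subtype.ext ((D.pullPoset_comp_obj ((arTarget m.unop).prod OrderHom.id)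
      (biMap θ.unop θ.unop) F.1).symm.trans (D.pullPoset_comp_obj (Ar.map θ.unop)
      ((arTarget n.unop).prod OrderHom.id) F.1))

theorem incl_retr (hD : D.IsRightDerivator) : D.incl ≫ D.retr hD = 𝟙 D.sConstruction := by
  ext n F
  refine Subtype.ext ((D.pullPoset_comp_obj ((arTarget n.unop).prod OrderHom.id)
    (arProj n.unop n.unop) F.1).symm.trans ?_)
  exact D.pullPoset_id_obj F.1

/-- A natural family of monotone maps `[n] × Ar[n] ⟶ [n]`, that is, a family compatible with the
simplicial operators. -/
structure NaturalMap where
  map (n : SimplexCategory) : Fin (n.len + 1) × Ar n →o Fin (n.len + 1)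
  naturality {m n : SimplexCategory} (θ : m ⟶ n) (x : Fin (m.len + 1) × Ar m) :
    map n (biMap θ θ x) = θ.toOrderHom (map m x)

/-- The endomorphism of the diagonal of `S_••` induced by a natural family of maps
`[n] × Ar[n] ⟶ [n]`. -/
def NaturalMap.endo (u : NaturalMap) (hD : D.IsRightDerivator) : D.diagSBi ⟶ D.diagSBi where
  app n := ↾fun F => ⟨(D.pullPoset ((u.map n.unop).prod OrderHom.snd)).obj F.1,
    F.2.pull_graph hD _⟩
  naturality n m θ := by
    refine ConcreteCategory.hom_ext _ _ fun F => Subtype.ext ?_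
    refine (D.pullPoset_comp_obj ((u.map m.unop).prod OrderHom.snd) (biMap θ.unop θ.unop)
      F.1).symm.trans (Eq.trans ?_ (D.pullPoset_comp_obj (biMap θ.unop θ.unop)
      ((u.map n.unop).prod OrderHom.snd) F.1))
    congr 2
    ext x : 2
    exact Prod.ext (u.naturality θ.unop x).symm rfl

/-- If `u ≤ v`, then `u` where `a (j) = 0` and `v` where `a (j) = 1` is a monotone map
`[n] × Ar[n] ⟶ [n]`. -/
def NaturalMap.switch (u v : NaturalMap) (huv : ∀ n, u.map n ≤ v.map n) (n : SimplexCategory)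
    (a : Fin (n.len + 1) →o Fin 2) : Fin (n.len + 1) × Ar n →o Fin (n.len + 1) where
  toFun x := if a x.2.1.2 = 0 then u.map n x else v.map n x
  monotone' x y h := by
    have ha : a x.2.1.2 ≤ a y.2.1.2 := a.monotone h.2.2
    dsimp only
    split_ifs with hx hy hy
    · exact (u.map n).monotone h
    · exact ((u.map n).monotone h).trans (huv n y)
    · rw [hy] at ha
      exact absurd (Fin.le_zero_iff.1 ha) hx
    · exact (v.map n).monotone h

/-- The endomorphisms induced by comparable natural families are homotopic. -/
def NaturalMap.homotopy (u v : NaturalMap) (huv : ∀ n, u.map n ≤ v.map n)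
    (hD : D.IsRightDerivator) : SimplicialHomotopy (u.endo (D := D) hD) (v.endo hD) where
  h {n} F a := ⟨(D.pullPoset ((u.switch v huv n a).prod OrderHom.snd)).obj F.1,
    F.2.pull_graph hD _⟩
  map_h {n m} θ F a := by
    refine Subtype.ext ?_
    refine (D.pullPoset_comp_obj (biMap θ θ) ((u.switch v huv n a).prod OrderHom.snd)
      F.1).symm.trans (Eq.trans ?_ (D.pullPoset_comp_obj
      ((u.switch v huv m (a.comp θ.toOrderHom)).prod OrderHom.snd) (biMap θ θ) F.1))
    congr 2
    ext x : 2
    refine Prod.ext ?_ rfl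
    change (if _ then _ else _) = θ.toOrderHom (if _ then _ else _)
    rw [apply_ite θ.toOrderHom, u.naturality, v.naturality]
    rfl
  h_zero F := rfl
  h_one F := rfl

theorem NaturalMap.endo_incl (u : NaturalMap) (hD : D.IsRightDerivator) {n : SimplexCategory}
    (F : D.sConstruction.obj (op n)) :
    (u.endo hD).app (op n) (D.incl.app (op n) F) = D.incl.app (op n) F :=
  Subtype.ext (D.pullPoset_comp_obj ((u.map n).prod OrderHom.snd) (arProj n n) F.1).symm

theorem NaturalMap.homotopicRel (u v : NaturalMap) (huv : ∀ n, u.map n ≤ v.map n)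
    (hD : D.IsRightDerivator) :
    (SSet.toTop.map (u.endo (D := D) hD)).hom.HomotopicRel (SSet.toTop.map (v.endo hD)).hom
      (Set.range D.inclRealization) :=
  (u.homotopy v huv hD).homotopicRel_toTop D.incl fun {n} F a =>
    (Subtype.ext (D.pullPoset_comp_obj ((u.switch v huv n a).prod OrderHom.snd) (arProj n n)
      F.1).symm).trans (u.endo_incl hD F).symm

/-- The natural family `(x, i ⟶ j) ↦ x`. -/
def NaturalMap.left : NaturalMap where
  map _ := OrderHom.fst
  naturality _ _ := rfl

/-- The natural family `(x, i ⟶ j) ↦ j`. -/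
def NaturalMap.target : NaturalMap where
  map n := (arTarget n).comp OrderHom.snd
  naturality _ _ := rfl

/-- The natural family `(x, i ⟶ j) ↦ max x j`. -/
def NaturalMap.max : NaturalMap where
  map n := OrderHom.fst ⊔ (arTarget n).comp OrderHom.snd
  naturality θ x := (θ.toOrderHom.monotone.map_sup x.1 x.2.1.2).symm

theorem NaturalMap.endo_left (hD : D.IsRightDerivator) :
    NaturalMap.left.endo hD = 𝟙 D.diagSBi := by
  ext n F
  exact Subtype.ext (D.pullPoset_id_obj F.1)

theorem NaturalMap.endo_target (hD : D.IsRightDerivator) :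
    NaturalMap.target.endo hD = D.retr hD ≫ D.incl := by
  ext n F
  exact Subtype.ext (D.pullPoset_comp_obj (arProj n.unop n.unop)
    ((arTarget n.unop).prod OrderHom.id) F.1)

/-- The homotopies compare the identity and the retraction with the endomorphism induced by
`(x, i ⟶ j) ↦ max x j`. -/
theorem homotopicRel_incl_retr (hD : D.IsRightDerivator) :
    (ContinuousMap.id (SSet.toTop.obj D.diagSBi)).HomotopicRel
      (D.inclRealization.comp (SSet.toTop.map (D.retr hD)).hom) (Set.range D.inclRealization) := by
  have h₁ := NaturalMap.left.homotopicRel .max (fun n => le_sup_left) hD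
  have h₂ := NaturalMap.target.homotopicRel .max (fun n => le_sup_right) hD
  rw [NaturalMap.endo_left, CategoryTheory.Functor.map_id] at h₁
  rw [NaturalMap.endo_target, CategoryTheory.Functor.map_comp] at h₂
  exact h₁.trans h₂.symm

end Prederivator

end DerivatorKTheory

theorem mainTheorem5 (Dia : DerivatorKTheory.DiagramCategory.{w})
    (D : DerivatorKTheory.Prederivator.{w, v, u} Dia) (hD : D.IsPointedRightDerivator)
    (b : SSet.toTop.obj D.sConstruction) :
    DerivatorKTheory.IsWeakEquivalence (D.comparison b) := by
  have hr := congrArg SSet.toTop.map (D.incl_retr hD.toIsRightDerivator)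
  rw [CategoryTheory.Functor.map_comp, CategoryTheory.Functor.map_id] at hr
  exact DerivatorKTheory.isWeakEquivalence_loopMap D.inclRealization
    (SSet.toTop.map (D.retr hD.toIsRightDerivator)).hom
    (fun x => ConcreteCategory.congr_hom hr x)
    (D.homotopicRel_incl_retr hD.toIsRightDerivator) b
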